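/- Let $k\in\mathbb N$, let $A\in\mathbb R^{k\times k}$ be symmetric and positive definite, and let $(N(n))_{n\in\mathbb N}$ be a strictly increasing sequence of natural numbers; write $N=N(n)$. For each $n$ let $B_1^{(n)},\dots,B_k^{(n)}$ be a partition of $\{1,\dots,N\}$ into $k$ blocks, and assume that for every $i=1,\dots,k$ the limit $$\gamma_i:=\lim_{n\to\infty}\sqrt{|B_i^{(n)}|/N}$$ exists and is strictly positive. Put $\Gamma_\infty:=\operatorname{diag}(\gamma_1,\dots,\gamma_k)$. Let $J_n\in\mathbb R^{N\times N}$ be the matrix with entries $(J_n)_{uv}=\frac1N A_{ij}$ for $u\in B_i^{(n)}$, $v\in B_j^{(n)}$, and let $\mu_{J_n}$ be the probability measure on $\{-1,+1\}^N$ given by $$\mu_{J_n}(x)=Z_n^{-1}\exp\Big(\tfrac12\langle x,J_nx\rangle\Big),\qquad Z_n=\sum_{x\in\{-1,+1\}^N}\exp\Big(\tfrac12\langle x,J_nx\rangle\Big).$$ Let $\tilde m^{(n)}(x)=\Big(\frac1{|B_i^{(n)}|}\sum_{j\in B_i^{(n)}}x_j\Big)_{i=1,\dots,k}\in\mathbb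 R^k$ be the normalized block magnetization vector (a component belonging to an empty block, which can occur for finitely many $n$ only, is set to $0$). Let $L^*(x)=\sup_{t\in\mathbb R}\,(tx-\log\cosh t)\in[0,+\infty]$ be the convex conjugate of $\log\cosh$, and define, for $x\in\mathbb R^k$, $$I(x)=\tfrac12\langle x,\Gamma_\infty^2A\Gamma_\infty^2x\rangle-\sum_{i=1}^k\gamma_i^2L^*(x_i)\in[-\infty,\infty),\qquad J(x)=\sup_{y\in\mathbb R^k}I(y)-I(x).$$ Then $$L^*(x)=\tfrac12(1+x)\log(1+x)+\tfrac12(1-x)\log(1-x)\quad\text{for }x\in[-1,1]$$ (with $0\log 0=0$), and $\tilde m^{(n)}$ satisfies a large deviation principle under $\mu_{J_n}$ with speed $N$ and rate function $J$. That is, $J:\mathbb R^k\to[0,\infty]$ is lower semicontinuous with compact level sets $\{J\le L\}$, $L\in\mathbb R$, and the laws $\nu_n$ of $\tilde m^{(n)}$ under $\mu_{J_n}$ satisfy, for every Borel set $B\subseteq\mathbb R^k$, $$-\inf_{x\in\operatorname{int}B}J(x)\le\liminf_{n\to\infty}\frac{\log\nu_n(B)}{N}\le\limsup_{n\to\infty}\frac{\log\nu_n(B)}{N}\le-\inf_{x\in\operatorname{cl}B}J(x),$$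 with $\log 0=-\infty$ and $\inf\emptyset=+\infty$. -/

import Mathlib

open MeasureTheory Filter Topology

noncomputable section

namespace BlockSpin

/-- A rate function with values in `[0, ∞]` (as a subset of `EReal`): lower semicontinuous
with compact sublevel sets. -/
structure IsGoodRateFunction {X : Type*} [TopologicalSpace X] (J : X → EReal) : Prop where
  nonneg : ∀ x, 0 ≤ J x
  lowerSemicontinuous : LowerSemicontinuous J
  isCompact_sublevel : ∀ L : ℝ, IsCompact {x | J x ≤ (L : EReal)}

/-- The sequence `ν` of probability measures satisfies a large deviation principle with speed
`a` and rate function `J`. Here `ENNReal.log 0 = ⊥` and the infimum over `∅` is `⊤`. -/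
structure SatisfiesLDP {X : Type*} [TopologicalSpace X] [MeasurableSpace X]
    (ν : ℕ → Measure X) (a : ℕ → ℝ) (J : X → EReal) : Prop where
  isProbabilityMeasure : ∀ n, IsProbabilityMeasure (ν n)
  speed_nonneg : ∀ n, 0 ≤ a n
  speed_mono : Monotone a
  isGoodRateFunction : IsGoodRateFunction J
  lower_bound : ∀ B : Set X, MeasurableSet B →
    -(⨅ x ∈ interior B, J x) ≤ liminf (fun n => ENNReal.log (ν n B) / (a n : EReal)) atTop
  upper_bound : ∀ B : Set X, MeasurableSet B →
    limsup (fun n => ENNReal.log (ν n B) / (a n : EReal)) atTop ≤ -(⨅ x ∈ closure B, J x)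

/-- Spin configurations `{-1, +1}^N`; the two units of `ℤ` are `1` and `-1`. -/
abbrev Config (N : ℕ) : Type := Fin N → ℤˣ

/-- Every set of spin values is measurable, hence so is every set of configurations. -/
instance : DiscreteMeasurableSpace ℤˣ :=
  ⟨fun s => ⟨Units.val '' s, MeasurableSet.of_discrete,
    Set.preimage_image_eq s Units.val_injective⟩⟩

/-- A configuration as a real vector. -/
def Config.toVec {N : ℕ} (x : Config N) : Fin N → ℝ := fun i => ((x i : ℤ) : ℝ)

/-- A partition of `N` sites into `k` blocks is given by the map `b` sending each site to the
index of its block; this is the `i`-th block. -/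
def block {N k : ℕ} (b : Fin N → Fin k) (i : Fin k) : Finset (Fin N) :=
  Finset.univ.filter fun j => b j = i

/-- The interaction matrix `J_n`, with entry `A i j / N` at two sites in blocks `i` and `j`. -/
def interaction {N k : ℕ} (A : Matrix (Fin k) (Fin k) ℝ) (b : Fin N → Fin k) :
    Matrix (Fin N) (Fin N) ℝ :=
  Matrix.of fun u v => (1 / (N : ℝ)) * A (b u) (b v)

/-- The Hamiltonian `½ ⟨x, J x⟩`. -/
def hamiltonian {N : ℕ} (J : Matrix (Fin N) (Fin N) ℝ) (x : Config N) : ℝ :=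
  (1 / 2) * (x.toVec ⬝ᵥ J.mulVec x.toVec)

/-- The partition function. -/
def partitionFunction {N : ℕ} (J : Matrix (Fin N) (Fin N) ℝ) : ℝ :=
  ∑ x : Config N, Real.exp (hamiltonian J x)

/-- The Ising measure `μ_J` on `{-1, +1}^N`. -/
def isingMeasure {N : ℕ} (J : Matrix (Fin N) (Fin N) ℝ) : Measure (Config N) :=
  ∑ x : Config N,
    ENNReal.ofReal ((partitionFunction J)⁻¹ * Real.exp (hamiltonian J x)) • Measure.dirac x

/-- The normalized block magnetization vector. -/
def magnetization {N k : ℕ} (b : Fin N → Fin k) (x : Config N) : Fin k → ℝ :=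
  fun i => (1 / ((block b i).card : ℝ)) * ∑ j ∈ block b i, x.toVec j

/-- The convex conjugate of `log cosh`, with values in the extended reals. -/
def logCoshConj (x : ℝ) : EReal :=
  ⨆ t : ℝ, ((t * x - Real.log (Real.cosh t) : ℝ) : EReal)

/-- `I(x) = ½ ⟨x, Γ² A Γ² x⟩ - ∑ i, γ i ^ 2 * L*(x i)` with `Γ = diag γ`; the value is `⊥`
where some `L*(x i)` is infinite. -/
def energyEntropy {k : ℕ} (A : Matrix (Fin k) (Fin k) ℝ) (γ : Fin k → ℝ) (x : Fin k → ℝ) :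
    EReal :=
  (((1 / 2) * (x ⬝ᵥ ((Matrix.diagonal γ) ^ 2 * A * (Matrix.diagonal γ) ^ 2).mulVec x) : ℝ) :
      EReal)
    - ∑ i, ((γ i ^ 2 : ℝ) : EReal) * logCoshConj (x i)

/-- The rate function `sup I - I(x)`. -/
def rate {k : ℕ} (A : Matrix (Fin k) (Fin k) ℝ) (γ : Fin k → ℝ) (x : Fin k → ℝ) : EReal :=
  (⨆ y : Fin k → ℝ, energyEntropy A γ y) - energyEntropy A γ x

end BlockSpin

end

/-! The law of the block magnetization can be computed almost exactly, so the proof is a direct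
Laplace argument. With `p` the relative block sizes and `m` the block magnetization, the energy is
`N` times ½⟨p*m, A(p*m)⟩ (`hamiltonian_interaction`). The configurations with given numbers of
positive spins are counted by a product of binomial coefficients (`card_filter_upCount_eq`), each
equal to the exponential of block size times binary entropy up to a polynomial factor
(`log_choose_le`, `le_log_choose`). So an attainable `m` carries weight exp(N (log 2 + `pressure A p
m`)) up to factors polynomial in `N`, and there are at most (N+1)^k attainable values (`weight_le`,
`le_weight`).

As `N` grows, `p` tends to γ². Since `pressure` is jointly continuous and `m` stays in the compact
cube [-1,1]^k, the exponent may be replaced by its limit (`eventually_weight_le`,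
`eventually_le_weight`). Dividing by the partition function subtracts the maximum of the limiting
pressure.

The link with the stated rate is that L* is log 2 minus the binary entropy of (1+x)/2 on [-1,1] and
infinite elsewhere. Hence I is the limiting pressure on the cube and `⊥` outside it
(`energyEntropy_of_mem`, `energyEntropy_of_notMem`). -/

noncomputable section

namespace BlockSpin

/-! ### The convex conjugate of log cosh -/

/-- The entropy deficit `log 2 - h((1 + x) / 2)` of a spin with mean `x`, where `h` is the binary
entropy. -/
def entropyDeficit (x : ℝ) : ℝ := Real.log 2 - Real.binEntropy ((1 + x) / 2)

lemma continuous_entropyDeficit : Continuous entropyDeficit := by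
  unfold entropyDeficit
  fun_prop

lemma half_mul_log_half (y : ℝ) :
    y / 2 * Real.log (y / 2) = 1 / 2 * y * Real.log y - y / 2 * Real.log 2 := by
  rcases eq_or_ne y 0 with rfl | hy
  · simp
  · rw [Real.log_div hy two_ne_zero]; ring

lemma entropyDeficit_eq (x : ℝ) : entropyDeficit x =
    (1 / 2) * (1 + x) * Real.log (1 + x) + (1 / 2) * (1 - x) * Real.log (1 - x) := by
  have h1 := half_mul_log_half (1 + x)
  have h2 := half_mul_log_half (1 - x)
  have e : 1 - (1 + x) / 2 = (1 - x) / 2 := by ring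
  rw [entropyDeficit, Real.binEntropy_eq_negMulLog_add_negMulLog_one_sub, e, Real.negMulLog,
    Real.negMulLog]
  linarith

/-- One summand of Gibbs' inequality: log u ≤ u - 1 at u = a / (q c), multiplied by `q`. Adding the
summands for the two spin values, with `a` equal to exp(±t)/2 and `c` equal to cosh t, yields
Fenchel's inequality. -/
lemma mul_log_div_le {q a c : ℝ} (hq : 0 ≤ q) (ha : 0 < a) (hc : 0 < c) :
    q * (Real.log a - Real.log c) - q * Real.log q ≤ a / c - q := by
  rcases hq.eq_or_lt with rfl | hq
  · simp; positivity
  · have h := Real.log_le_sub_one_of_pos (show 0 < a / (q * c) by positivity)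
    rw [Real.log_div ha.ne' (by positivity), Real.log_mul hq.ne' hc.ne'] at h
    have h2 := mul_le_mul_of_nonneg_left h hq.le
    have e : q * (a / (q * c) - 1) = a / c - q := by field_simp
    rw [e] at h2
    linarith

/-- Fenchel's inequality for `log cosh`. -/
lemma mul_sub_log_cosh_le {x : ℝ} (hx : x ∈ Set.Icc (-1 : ℝ) 1) (t : ℝ) :
    t * x - Real.log (Real.cosh t) ≤ entropyDeficit x := by
  have hc := Real.cosh_pos t
  have h1 := mul_log_div_le (q := (1 + x) / 2) (a := Real.exp t / 2) (by linarith [hx.1])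
    (by positivity) hc
  have h2 := mul_log_div_le (q := (1 - x) / 2) (a := Real.exp (-t) / 2) (by linarith [hx.2])
    (by positivity) hc
  have h3 : Real.exp t / 2 / Real.cosh t + Real.exp (-t) / 2 / Real.cosh t = 1 := by
    rw [← add_div, ← add_div, ← Real.cosh_eq, div_self hc.ne']
  rw [half_mul_log_half, Real.log_div (Real.exp_ne_zero _) two_ne_zero, Real.log_exp] at h1 h2
  rw [entropyDeficit_eq]
  linarith

/-- Equality in Fenchel's inequality at `t = artanh x`. -/
lemma exists_mul_sub_log_cosh_eq {x : ℝ} (hx : x ∈ Set.Ioo (-1 : ℝ) 1) :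
    ∃ t, t * x - Real.log (Real.cosh t) = entropyDeficit x := by
  have h1 : 0 < 1 + x := by linarith [hx.1]
  have h2 : 0 < 1 - x := by linarith [hx.2]
  refine ⟨(Real.log (1 + x) - Real.log (1 - x)) / 2, ?_⟩
  set t := (Real.log (1 + x) - Real.log (1 - x)) / 2 with ht
  -- `s` is log √(1 - x²), the normalization for which exp(±t) = (1 ± x) exp(-s), whence cosh t =
  -- exp(-s).
  set s := (Real.log (1 + x) + Real.log (1 - x)) / 2 with hs
  have e1 : Real.exp t = (1 + x) * Real.exp (-s) := by
    nth_rewrite 1 [← Real.exp_log h1]; rw [← Real.exp_add, ht, hs]; congr 1; ring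
  have e2 : Real.exp (-t) = (1 - x) * Real.exp (-s) := by
    nth_rewrite 1 [← Real.exp_log h2]; rw [← Real.exp_add, ht, hs]; congr 1; ring
  have hcosh : Real.cosh t = Real.exp (-s) := by
    rw [Real.cosh_eq, e1, e2]; ring
  rw [hcosh, Real.log_exp, entropyDeficit_eq, ht, hs]
  ring

lemma le_logCoshConj (x t : ℝ) :
    ((t * x - Real.log (Real.cosh t) : ℝ) : EReal) ≤ logCoshConj x :=
  le_iSup (fun t : ℝ => ((t * x - Real.log (Real.cosh t) : ℝ) : EReal)) t

lemma logCoshConj_neg (x : ℝ) : logCoshConj (-x) = logCoshConj x := by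
  unfold logCoshConj
  rw [← (Equiv.neg ℝ).iSup_comp]
  simp

lemma entropyDeficit_one : entropyDeficit 1 = Real.log 2 := by
  simp [entropyDeficit]

lemma entropyDeficit_neg (x : ℝ) : entropyDeficit (-x) = entropyDeficit x := by
  rw [entropyDeficit_eq, entropyDeficit_eq, ← sub_eq_add_neg, sub_neg_eq_add]
  ring

/-- At the endpoint no `t` attains the supremum. It is approached as `t` → ∞, because t - log cosh t
= log 2 - log(1 + exp(-2t)). -/
lemma log_two_le_logCoshConj_one : ((Real.log 2 : ℝ) : EReal) ≤ logCoshConj 1 := by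
  have hlim : Tendsto (fun t : ℝ => Real.log 2 - Real.log (1 + Real.exp (-(2 * t)))) atTop
      (𝓝 (Real.log 2 - Real.log (1 + 0))) := by
    refine Tendsto.sub tendsto_const_nhds (Tendsto.log (tendsto_const_nhds.add ?_) (by norm_num))
    exact Real.tendsto_exp_neg_atTop_nhds_zero.comp
      (tendsto_id.const_mul_atTop (by norm_num : (0 : ℝ) < 2))
  simp only [add_zero, Real.log_one, sub_zero] at hlim
  refine le_of_tendsto (continuous_coe_real_ereal.continuousAt.tendsto.comp hlim)
    (Eventually.of_forall fun t => ?_)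
  have h := le_logCoshConj 1 t
  have e : Real.cosh t = Real.exp t * (1 + Real.exp (-(2 * t))) / 2 := by
    rw [Real.cosh_eq, mul_add, ← Real.exp_add]; ring_nf
  have e2 : t * 1 - Real.log (Real.cosh t) = Real.log 2 - Real.log (1 + Real.exp (-(2 * t))) := by
    rw [e, Real.log_div (by positivity) two_ne_zero, Real.log_mul (by positivity) (by positivity),
      Real.log_exp]
    ring
  rw [e2] at h
  exact h

/-- The convex conjugate of `log cosh` on its effective domain. -/
lemma logCoshConj_of_mem {x : ℝ} (hx : x ∈ Set.Icc (-1 : ℝ) 1) :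
    logCoshConj x = (entropyDeficit x : EReal) := by
  apply le_antisymm
  · exact iSup_le fun t => EReal.coe_le_coe_iff.2 (mul_sub_log_cosh_le hx t)
  · by_cases h : x ∈ Set.Ioo (-1 : ℝ) 1
    · obtain ⟨t, ht⟩ := exists_mul_sub_log_cosh_eq h
      exact ht ▸ le_logCoshConj x t
    · have h1 : x = 1 ∨ x = -1 := by
        by_contra! hne
        exact h ⟨lt_of_le_of_ne hx.1 hne.2.symm, lt_of_le_of_ne hx.2 hne.1⟩
      rcases h1 with rfl | rfl
      · rw [entropyDeficit_one]; exact log_two_le_logCoshConj_one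
      · rw [logCoshConj_neg, entropyDeficit_neg, entropyDeficit_one]
        exact log_two_le_logCoshConj_one

/-- For t ≥ 0, log cosh t ≤ t, so the quantity under the supremum is at least t (x - 1), which is
unbounded. -/
lemma logCoshConj_of_one_lt {x : ℝ} (hx : 1 < x) : logCoshConj x = ⊤ := by
  rw [EReal.eq_top_iff_forall_lt]
  intro y
  obtain ⟨t, ht0, ht⟩ : ∃ t : ℝ, 0 ≤ t ∧ y < t * (x - 1) := by
    refine ⟨(|y| + 1) / (x - 1), div_nonneg (by positivity) (by linarith), ?_⟩
    rw [div_mul_cancel₀ _ (by linarith : x - 1 ≠ 0)]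
    linarith [le_abs_self y]
  refine lt_of_lt_of_le (EReal.coe_lt_coe_iff.2 ?_) (le_logCoshConj x t)
  have h1 : Real.cosh t ≤ Real.exp t := by
    rw [Real.cosh_eq]
    have := Real.exp_le_exp.2 (show -t ≤ t by linarith)
    linarith
  have h2 := Real.log_le_log (Real.cosh_pos t) h1
  rw [Real.log_exp] at h2
  linarith

lemma logCoshConj_of_notMem {x : ℝ} (hx : x ∉ Set.Icc (-1 : ℝ) 1) : logCoshConj x = ⊤ := by
  rw [Set.mem_Icc, not_and_or, not_le, not_le] at hx
  rcases hx with hx | hx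
  · rw [← logCoshConj_neg]; exact logCoshConj_of_one_lt (by linarith)
  · exact logCoshConj_of_one_lt hx

/-! ### Entropy bounds for binomial coefficients -/

/-- A crude Stirling bound suffices, since errors of order log n vanish at speed `N`. The induction
step reduces to (n+1) log(n/(n+1)) ≤ -1. The convention log 0 = 0 covers n = 0. -/
lemma log_factorial_le (n : ℕ) :
    Real.log (n.factorial : ℝ) ≤ 1 + Real.log n + n * Real.log n - n := by
  induction n with
  | zero => simp
  | succ n ih =>
    rw [Nat.factorial_succ, Nat.cast_mul, Real.log_mul (by positivity) (by positivity)]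
    rcases n.eq_zero_or_pos with rfl | hn
    · simp
    · have hn' : (0 : ℝ) < n := by exact_mod_cast hn
      have h := Real.log_le_sub_one_of_pos (show (0 : ℝ) < n / (n + 1) by positivity)
      rw [Real.log_div (by positivity) (by positivity)] at h
      have h2 := mul_le_mul_of_nonneg_left h (show (0 : ℝ) ≤ n + 1 by positivity)
      have e : ((n : ℝ) + 1) * (n / (n + 1) - 1) = -1 := by field_simp; ring
      rw [e] at h2
      push_cast
      nlinarith

lemma le_log_factorial (n : ℕ) : n * Real.log n - n ≤ Real.log (n.factorial : ℝ) := by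
  rcases n.eq_zero_or_pos with rfl | hn
  · simp
  · have h := Real.pow_div_factorial_le_exp (n : ℝ) (by positivity) n
    have h2 := Real.log_le_log (by positivity) h
    rw [Real.log_div (by positivity) (by positivity), Real.log_pow, Real.log_exp] at h2
    linarith

lemma mul_binEntropy_div (l r : ℕ) : ((l + r : ℕ) : ℝ) * Real.binEntropy (l / (l + r : ℕ)) =
    ((l + r : ℕ) : ℝ) * Real.log (l + r : ℕ) - l * Real.log l - r * Real.log r := by
  rcases l.eq_zero_or_pos with rfl | hl
  · simp
  rcases r.eq_zero_or_pos with rfl | hr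
  · simp [hl.ne']
  have hl' : (0 : ℝ) < l := by exact_mod_cast hl
  have hr' : (0 : ℝ) < r := by exact_mod_cast hr
  have e : 1 - (l : ℝ) / (l + r : ℕ) = r / (l + r : ℕ) := by push_cast; field_simp; ring
  rw [Real.binEntropy_eq_negMulLog_add_negMulLog_one_sub, e, Real.negMulLog, Real.negMulLog,
    Real.log_div hl'.ne' (by positivity), Real.log_div hr'.ne' (by positivity)]
  push_cast
  field_simp
  ring

/-- The error is twice 1 + log(n+1), one for each factorial in the denominator. -/
lemma le_log_choose {n l : ℕ} (hl : l ≤ n) :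
    n * Real.binEntropy (l / n) - (2 + 2 * Real.log (n + 1)) ≤ Real.log (n.choose l : ℝ) := by
  obtain ⟨r, rfl⟩ := Nat.exists_eq_add_of_le hl
  have hlog : ∀ m ≤ l + r, Real.log m ≤ Real.log ((l + r : ℕ) + 1) := by
    intro m hm
    rcases m.eq_zero_or_pos with rfl | hm0
    · simpa using Real.log_nonneg (show (1 : ℝ) ≤ l + r + 1 by
        have : (0 : ℝ) ≤ l + r := by positivity
        linarith)
    · exact Real.log_le_log (by positivity) (by exact_mod_cast hm.trans (Nat.le_succ _))
  have h1 := le_log_factorial (l + r)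
  have h2 := log_factorial_le l
  have h3 := log_factorial_le r
  have h4 := hlog l (by omega)
  have h5 := hlog r (by omega)
  have hc := Nat.add_choose_mul_factorial_mul_factorial l r
  rw [← Nat.choose_symm_add] at hc
  have hpos : (0 : ℝ) < ((l + r).choose l : ℕ) := by exact_mod_cast Nat.choose_pos hl
  have hc' := congrArg (fun m : ℕ => Real.log m) hc
  simp only [Nat.cast_mul] at hc'
  rw [Real.log_mul (by positivity) (by positivity), Real.log_mul hpos.ne' (by positivity)]
    at hc'
  rw [mul_binEntropy_div]
  push_cast at *
  linarith

/-- There is no error term: the bound comes from keeping a single term in the binomial expansion of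
(l + r)^(l + r). -/
lemma log_choose_le {n l : ℕ} (hl : l ≤ n) :
    Real.log (n.choose l : ℝ) ≤ n * Real.binEntropy (l / n) := by
  obtain ⟨r, rfl⟩ := Nat.exists_eq_add_of_le hl
  have hpos : (0 : ℝ) < ((l + r).choose l : ℕ) := by exact_mod_cast Nat.choose_pos hl
  have hterm : (l : ℝ) ^ l * (r : ℝ) ^ r * ((l + r).choose l : ℕ) ≤ ((l : ℝ) + r) ^ (l + r) := by
    rw [add_pow]
    have := Finset.single_le_sum (f := fun m => (l : ℝ) ^ m * (r : ℝ) ^ (l + r - m) *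
      ((l + r).choose m : ℕ)) (fun _ _ => by positivity)
      (Finset.mem_range.2 (show l < l + r + 1 by omega))
    simpa using this
  have hpow : ∀ m : ℕ, (0 : ℝ) < (m : ℝ) ^ m := fun m => by
    rcases m.eq_zero_or_pos with rfl | hm
    · simp
    · positivity
  have h := Real.log_le_log (mul_pos (mul_pos (hpow l) (hpow r)) hpos) hterm
  rw [Real.log_mul (mul_pos (hpow l) (hpow r)).ne' hpos.ne',
    Real.log_mul (hpow l).ne' (hpow r).ne', Real.log_pow, Real.log_pow, Real.log_pow] at h
  rw [mul_binEntropy_div]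
  push_cast at *
  linarith

/-! ### Energy and multiplicity as functions of the block counts -/

/-- The relative block sizes. -/
def blockFrac {N k : ℕ} (b : Fin N → Fin k) : Fin k → ℝ :=
  fun i => ((block b i).card : ℝ) / N

/-- The number of positive spins in each block. -/
def upCount {N k : ℕ} (b : Fin N → Fin k) (x : Config N) : Fin k → ℕ :=
  fun i => ((block b i).filter fun j => x j = 1).card

/-- The block magnetization of a configuration with `c i` positive spins in block `i`. -/
def gridPoint {N k : ℕ} (b : Fin N → Fin k) (c : Fin k → ℕ) : Fin k → ℝ :=
  fun i => (1 / ((block b i).card : ℝ)) * (2 * c i - (block b i).card)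

/-- The exponential growth rate, relative to `2 ^ N`, of the weight of the configurations with
block magnetization `m`, when the blocks have relative sizes `p`. -/
def pressure {k : ℕ} (A : Matrix (Fin k) (Fin k) ℝ) (p m : Fin k → ℝ) : ℝ :=
  (1 / 2) * ((p * m) ⬝ᵥ A.mulVec (p * m)) - ∑ i, p i * entropyDeficit (m i)

lemma upCount_le {N k : ℕ} (b : Fin N → Fin k) (x : Config N) (i : Fin k) :
    upCount b x i ≤ (block b i).card :=
  Finset.card_filter_le _ _

lemma card_block_le {N k : ℕ} (b : Fin N → Fin k) (i : Fin k) : (block b i).card ≤ N :=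
  (Finset.card_le_univ _).trans_eq (Fintype.card_fin N)

lemma sum_card_block {N k : ℕ} (b : Fin N → Fin k) : ∑ i, (block b i).card = N := by
  have h := Finset.card_eq_sum_card_fiberwise (s := Finset.univ) (t := Finset.univ) (f := b)
    (fun _ _ => Finset.mem_coe.2 (Finset.mem_univ _))
  simpa [block] using h.symm

lemma toVec_eq_ite {N : ℕ} (x : Config N) (j : Fin N) :
    x.toVec j = 2 * (if x j = 1 then 1 else 0) - 1 := by
  rcases Int.units_eq_one_or (x j) with h | h <;> norm_num [Config.toVec, h]

lemma magnetization_eq_gridPoint {N k : ℕ} (b : Fin N → Fin k) (x : Config N) :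
    magnetization b x = gridPoint b (upCount b x) := by
  funext i
  simp only [magnetization, gridPoint, upCount, toVec_eq_ite]
  rw [Finset.sum_sub_distrib, ← Finset.mul_sum, Finset.sum_boole]
  simp

lemma gridPoint_mem_Icc {N k : ℕ} (b : Fin N → Fin k) {c : Fin k → ℕ}
    (hc : ∀ i, c i ≤ (block b i).card) : gridPoint b c ∈ Set.Icc (-1 : Fin k → ℝ) 1 := by
  have key : ∀ i, gridPoint b c i ∈ Set.Icc (-1 : ℝ) 1 := by
    intro i
    have h1 : (c i : ℝ) ≤ (block b i).card := by exact_mod_cast hc i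
    have h0 : (0 : ℝ) ≤ c i := by positivity
    unfold gridPoint
    rcases (Nat.cast_nonneg (α := ℝ) (block b i).card).eq_or_lt with h | h
    · rw [← h]; simp
    · rw [one_div_mul_eq_div, Set.mem_Icc, le_div_iff₀ h, div_le_iff₀ h]
      constructor <;> linarith
  exact ⟨fun i => (key i).1, fun i => (key i).2⟩

lemma card_mul_entropyDeficit_gridPoint {N k : ℕ} (b : Fin N → Fin k) (c : Fin k → ℕ)
    (i : Fin k) : ((block b i).card : ℝ) * Real.binEntropy (c i / (block b i).card) =
      (block b i).card * Real.log 2 - (block b i).card * entropyDeficit (gridPoint b c i) := by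
  unfold entropyDeficit gridPoint
  rcases eq_or_ne ((block b i).card : ℝ) 0 with h | h
  · rw [h]; simp
  · have e : (1 + 1 / ((block b i).card : ℝ) * (2 * c i - (block b i).card)) / 2 =
        c i / (block b i).card := by field_simp; ring
    rw [e]; ring

/-- Multiplying by the block fraction cancels the block size and leaves the normalization 1/N of the
interaction. Both sides vanish for an empty block. -/
lemma blockFrac_mul_magnetization {N k : ℕ} (b : Fin N → Fin k) (x : Config N) (i : Fin k) :
    (blockFrac b * magnetization b x) i = (1 / (N : ℝ)) * ∑ j ∈ block b i, x.toVec j := by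
  simp only [Pi.mul_apply, blockFrac, magnetization]
  rcases eq_or_ne ((block b i).card : ℝ) 0 with h | h
  · have h' : block b i = ∅ := by simpa using h
    simp [h']
  · field_simp

lemma sum_block {N k : ℕ} (b : Fin N → Fin k) (f : Fin N → ℝ) :
    ∑ i, ∑ j ∈ block b i, f j = ∑ j, f j :=
  Finset.sum_fiberwise _ _ _

/-- The energy is a function of the block magnetization. -/
lemma hamiltonian_interaction {N k : ℕ} (hN : 0 < N) (A : Matrix (Fin k) (Fin k) ℝ)
    (b : Fin N → Fin k) (x : Config N) :
    hamiltonian (interaction A b) x = N * ((1 / 2) *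
      ((blockFrac b * magnetization b x) ⬝ᵥ A.mulVec (blockFrac b * magnetization b x))) := by
  have hN' : (N : ℝ) ≠ 0 := by exact_mod_cast hN.ne'
  have h1 : x.toVec ⬝ᵥ (interaction A b).mulVec x.toVec =
      (1 / (N : ℝ)) * ∑ i, ∑ i', A i i' * (∑ j ∈ block b i, x.toVec j) *
        ∑ j ∈ block b i', x.toVec j := by
    have h2 : ∀ u, (interaction A b).mulVec x.toVec u =
        (1 / (N : ℝ)) * ∑ i', A (b u) i' * ∑ j ∈ block b i', x.toVec j := by
      intro u
      simp only [Matrix.mulVec, dotProduct, interaction, Matrix.of_apply]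
      rw [← sum_block b, Finset.mul_sum]
      refine Finset.sum_congr rfl fun i' _ => ?_
      rw [Finset.mul_sum, Finset.mul_sum]
      refine Finset.sum_congr rfl fun j hj => ?_
      rw [(Finset.mem_filter.1 hj).2]
      ring
    simp only [dotProduct, h2]
    rw [← sum_block b, Finset.mul_sum]
    refine Finset.sum_congr rfl fun i _ => ?_
    have h3 : ∑ j ∈ block b i, x.toVec j *
        (1 / (N : ℝ) * ∑ i', A (b j) i' * ∑ j ∈ block b i', x.toVec j) =
        (∑ j ∈ block b i, x.toVec j) *
        (1 / (N : ℝ) * ∑ i', A i i' * ∑ j ∈ block b i', x.toVec j) := by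
      rw [Finset.sum_mul]
      refine Finset.sum_congr rfl fun j hj => ?_
      rw [(Finset.mem_filter.1 hj).2]
    rw [h3, mul_left_comm, Finset.mul_sum]
    congr 1
    refine Finset.sum_congr rfl fun i' _ => ?_
    ring
  rw [hamiltonian, h1]
  simp only [dotProduct, Matrix.mulVec, blockFrac_mul_magnetization]
  rw [mul_left_comm (N : ℝ)]
  congr 1
  rw [Finset.mul_sum, Finset.mul_sum]
  refine Finset.sum_congr rfl fun i _ => ?_
  rw [Finset.mul_sum, Finset.mul_sum, Finset.mul_sum]
  refine Finset.sum_congr rfl fun i' _ => ?_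
  field_simp

/-- The number of configurations with prescribed numbers of positive spins in the blocks. -/
lemma card_filter_upCount_eq {N k : ℕ} (b : Fin N → Fin k) (c : Fin k → ℕ) :
    (Finset.univ.filter fun x : Config N => upCount b x = c).card =
      ∏ i, ((block b i).card).choose (c i) := by
  classical
  have h : ∏ i, ((block b i).card).choose (c i) =
      (Fintype.piFinset fun i => Finset.powersetCard (c i) (block b i)).card := by
    simp [Fintype.card_piFinset]
  rw [h]
  -- A configuration corresponds to the family of its sets of positive sites, one inside each block.
  -- Conversely, the spin at `j` is read off from the set belonging to the block of `j`.
  refine Finset.card_nbij' (fun x i => (block b i).filter fun j => x j = 1)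
    (fun s j => if j ∈ s (b j) then 1 else -1) ?_ ?_ ?_ ?_
  · intro x hx
    have hx' := (Finset.mem_filter.1 (Finset.mem_coe.1 hx)).2
    rw [Finset.mem_coe, Fintype.mem_piFinset]
    intro i
    rw [Finset.mem_powersetCard]
    exact ⟨Finset.filter_subset _ _, congrFun hx' i⟩
  · intro s hs
    rw [Finset.mem_coe, Fintype.mem_piFinset] at hs
    rw [Finset.mem_coe, Finset.mem_filter]
    refine ⟨Finset.mem_univ _, funext fun i => ?_⟩
    have hi := Finset.mem_powersetCard.1 (hs i)
    rw [← hi.2, upCount]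
    congr 1
    ext j
    simp only [Finset.mem_filter, block, Finset.mem_univ, true_and]
    constructor
    · rintro ⟨rfl, hj⟩
      by_contra hne
      simp [hne] at hj
    · intro hj
      have hb : b j = i := (Finset.mem_filter.1 (hi.1 hj)).2
      subst hb
      simp [hj]
  · intro x _
    funext j
    rcases Int.units_eq_one_or (x j) with h | h <;> simp [block, h]
  · intro s hs
    rw [Finset.mem_coe, Fintype.mem_piFinset] at hs
    funext i
    have hi := Finset.mem_powersetCard.1 (hs i)
    ext j
    simp only [Finset.mem_filter, block, Finset.mem_univ, true_and]
    constructor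
    · rintro ⟨rfl, hj⟩
      by_contra hne
      simp [hne] at hj
    · intro hj
      have hb : b j = i := (Finset.mem_filter.1 (hi.1 hj)).2
      subst hb
      simp [hj]

/-! ### Weights of sets of magnetizations at finite N -/

/-- The total weight of the configurations whose block magnetization lies in `B`. -/
def weight {N k : ℕ} (A : Matrix (Fin k) (Fin k) ℝ) (b : Fin N → Fin k) (B : Set (Fin k → ℝ)) :
    ℝ := by
  classical
  exact ∑ x ∈ Finset.univ.filter (fun x : Config N => magnetization b x ∈ B),
    Real.exp (hamiltonian (interaction A b) x)

/-- Entropy plus energy gives the exponent in `pressure`. The block sizes sum to `N`, so the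
blockwise log 2 terms combine into N log 2. -/
lemma sum_card_mul_binEntropy {N k : ℕ} (hN : 0 < N) (A : Matrix (Fin k) (Fin k) ℝ)
    (b : Fin N → Fin k) (c : Fin k → ℕ) :
    (∑ i, ((block b i).card : ℝ) * Real.binEntropy (c i / (block b i).card)) +
      N * ((1 / 2) * ((blockFrac b * gridPoint b c) ⬝ᵥ A.mulVec (blockFrac b * gridPoint b c))) =
      N * (Real.log 2 + pressure A (blockFrac b) (gridPoint b c)) := by
  have hN' : (N : ℝ) ≠ 0 := by exact_mod_cast hN.ne'
  have h1 : ∑ i, ((block b i).card : ℝ) = N := by exact_mod_cast sum_card_block b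
  have h2 : ∑ i, ((block b i).card : ℝ) * entropyDeficit (gridPoint b c i) =
      N * ∑ i, blockFrac b i * entropyDeficit (gridPoint b c i) := by
    rw [Finset.mul_sum]
    refine Finset.sum_congr rfl fun i _ => ?_
    unfold blockFrac
    field_simp
  simp only [card_mul_entropyDeficit_gridPoint]
  rw [Finset.sum_sub_distrib, ← Finset.sum_mul, h1, h2, pressure]
  ring

lemma prod_choose_le {N k : ℕ} (b : Fin N → Fin k) {c : Fin k → ℕ}
    (hc : ∀ i, c i ≤ (block b i).card) :
    ((∏ i, ((block b i).card).choose (c i) : ℕ) : ℝ) ≤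
      Real.exp (∑ i, ((block b i).card : ℝ) * Real.binEntropy (c i / (block b i).card)) := by
  rw [Real.exp_sum, Nat.cast_prod]
  refine Finset.prod_le_prod (fun _ _ => by positivity) fun i _ => ?_
  rw [← Real.log_le_iff_le_exp (by exact_mod_cast Nat.choose_pos (hc i))]
  exact log_choose_le (hc i)

lemma le_prod_choose {N k : ℕ} (b : Fin N → Fin k) {c : Fin k → ℕ}
    (hc : ∀ i, c i ≤ (block b i).card) :
    Real.exp ((∑ i, ((block b i).card : ℝ) * Real.binEntropy (c i / (block b i).card)) -
      k * (2 + 2 * Real.log (N + 1))) ≤ ((∏ i, ((block b i).card).choose (c i) : ℕ) : ℝ) := by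
  have e : (k : ℝ) * (2 + 2 * Real.log (N + 1)) =
      ∑ _i : Fin k, (2 + 2 * Real.log ((N : ℝ) + 1)) := by
    simp [mul_add]
  rw [e, ← Finset.sum_sub_distrib, Real.exp_sum, Nat.cast_prod]
  refine Finset.prod_le_prod (fun _ _ => by positivity) fun i _ => ?_
  rw [← Real.le_log_iff_exp_le (by exact_mod_cast Nat.choose_pos (hc i))]
  refine le_trans ?_ (le_log_choose (hc i))
  have h1 : ((block b i).card : ℝ) ≤ N := by exact_mod_cast card_block_le b i
  have h2 := Real.log_le_log (show (0 : ℝ) < (block b i).card + 1 by positivity)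
    (add_le_add_left h1 1)
  linarith

/-- Group configurations by their vector of positive-spin counts. There are at most (N+1)^k classes,
and each has multiplicity times Boltzmann factor at most exp(N (log 2 + r)). -/
lemma weight_le {N k : ℕ} (hN : 0 < N) (A : Matrix (Fin k) (Fin k) ℝ) (b : Fin N → Fin k)
    (B : Set (Fin k → ℝ)) (r : ℝ)
    (hr : ∀ m ∈ B ∩ Set.Icc (-1) 1, pressure A (blockFrac b) m ≤ r) :
    weight A b B ≤ ((N : ℝ) + 1) ^ k * Real.exp (N * (Real.log 2 + r)) := by
  classical
  unfold weight
  rw [← Finset.sum_fiberwise_of_maps_to (g := upCount b)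
    (t := Fintype.piFinset fun _ : Fin k => Finset.range (N + 1))]
  · refine (Finset.sum_le_card_nsmul _ _ (Real.exp (N * (Real.log 2 + r))) ?_).trans_eq ?_
    · intro c _
      -- Only a nonempty class guarantees that its grid point is attained and lies in `B`, as `hr`
      -- requires. An empty class contributes zero.
      by_cases h : ∃ x : Config N, magnetization b x ∈ B ∧ upCount b x = c
      · obtain ⟨x₀, hx₀, rfl⟩ := h
        have hc := upCount_le b x₀
        set c := upCount b x₀
        have hB : gridPoint b c ∈ B := magnetization_eq_gridPoint b x₀ ▸ hx₀
        have hterm : ∀ x ∈ (Finset.univ.filter fun x : Config N => magnetization b x ∈ B).filter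
            (fun x => upCount b x = c), Real.exp (hamiltonian (interaction A b) x) ≤
              Real.exp (N * ((1 / 2) * ((blockFrac b * gridPoint b c) ⬝ᵥ
                A.mulVec (blockFrac b * gridPoint b c)))) := by
          intro x hx
          rw [hamiltonian_interaction hN, magnetization_eq_gridPoint, (Finset.mem_filter.1 hx).2]
        refine (Finset.sum_le_card_nsmul _ _ _ hterm).trans ?_
        rw [nsmul_eq_mul]
        have hcard : ((((Finset.univ.filter fun x : Config N => magnetization b x ∈ B).filter
            (fun x => upCount b x = c)).card : ℕ) : ℝ) ≤ Real.exp (∑ i, ((block b i).card : ℝ) *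
              Real.binEntropy (c i / (block b i).card)) := by
          refine le_trans ?_ (prod_choose_le b hc)
          rw [← card_filter_upCount_eq]
          exact_mod_cast Finset.card_le_card
            (Finset.filter_subset_filter _ (Finset.filter_subset _ _))
        refine (mul_le_mul_of_nonneg_right hcard (Real.exp_nonneg _)).trans ?_
        rw [← Real.exp_add, sum_card_mul_binEntropy hN, Real.exp_le_exp]
        have := hr _ ⟨hB, gridPoint_mem_Icc b hc⟩
        gcongr
      · rw [Finset.sum_eq_zero]
        · positivity
        · intro x hx
          simp only [Finset.mem_filter, Finset.mem_univ, true_and] at hx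
          exact absurd ⟨x, hx⟩ h
    · rw [Fintype.card_piFinset]
      simp
  · intro x _
    rw [Fintype.mem_piFinset]
    intro i
    rw [Finset.mem_range, Nat.lt_succ_iff]
    exact (upCount_le b x i).trans (card_block_le b i)

/-- A single class of configurations already gives the lower bound. The subtracted term is the
Stirling error summed over the `k` blocks. -/
lemma le_weight {N k : ℕ} (hN : 0 < N) (A : Matrix (Fin k) (Fin k) ℝ) (b : Fin N → Fin k)
    (B : Set (Fin k → ℝ)) {c : Fin k → ℕ} (hc : ∀ i, c i ≤ (block b i).card)
    (hB : gridPoint b c ∈ B) :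
    Real.exp (N * (Real.log 2 + pressure A (blockFrac b) (gridPoint b c)) -
      k * (2 + 2 * Real.log (N + 1))) ≤ weight A b B := by
  classical
  unfold weight
  have hsub : (Finset.univ.filter fun x : Config N => upCount b x = c) ⊆
      Finset.univ.filter fun x : Config N => magnetization b x ∈ B := by
    intro x hx
    rw [Finset.mem_filter] at hx ⊢
    exact ⟨hx.1, by rw [magnetization_eq_gridPoint, hx.2]; exact hB⟩
  refine le_trans ?_ (Finset.sum_le_sum_of_subset_of_nonneg hsub fun _ _ _ => Real.exp_nonneg _)
  have hterm : ∀ x ∈ Finset.univ.filter (fun x : Config N => upCount b x = c),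
      Real.exp (N * ((1 / 2) * ((blockFrac b * gridPoint b c) ⬝ᵥ
        A.mulVec (blockFrac b * gridPoint b c)))) ≤
        Real.exp (hamiltonian (interaction A b) x) := by
    intro x hx
    rw [hamiltonian_interaction hN, magnetization_eq_gridPoint, (Finset.mem_filter.1 hx).2]
  refine le_trans ?_ (Finset.card_nsmul_le_sum _ _ _ hterm)
  rw [nsmul_eq_mul, card_filter_upCount_eq, ← sum_card_mul_binEntropy hN, add_sub_right_comm,
    Real.exp_add]
  exact mul_le_mul_of_nonneg_right (le_prod_choose b hc) (Real.exp_nonneg _)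

/-- The law of the block magnetization in terms of weights. -/
lemma map_magnetization_apply {N k : ℕ} (A : Matrix (Fin k) (Fin k) ℝ) (b : Fin N → Fin k)
    {B : Set (Fin k → ℝ)} (hB : MeasurableSet B) :
    (isingMeasure (interaction A b)).map (magnetization b) B =
      ENNReal.ofReal (weight A b B / weight A b Set.univ) := by
  classical
  have hZ : partitionFunction (interaction A b) = weight A b Set.univ := by
    simp [partitionFunction, weight]
  have hZ0 : 0 ≤ weight A b Set.univ := by unfold weight; positivity
  rw [Measure.map_apply (Measurable.of_discrete) hB, isingMeasure, Measure.finsetSum_apply]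
  simp only [Measure.smul_apply, smul_eq_mul, hZ]
  generalize weight A b Set.univ = Z at hZ0
  rw [div_eq_inv_mul, weight, Finset.mul_sum, ENNReal.ofReal_sum_of_nonneg (fun _ _ => by positivity), Finset.sum_filter]
  refine Finset.sum_congr rfl fun x _ => ?_
  rw [Measure.dirac_apply' _ MeasurableSet.of_discrete]
  by_cases h : magnetization b x ∈ B <;> simp [Set.indicator, h]

lemma weight_univ_pos {N k : ℕ} (A : Matrix (Fin k) (Fin k) ℝ) (b : Fin N → Fin k) :
    0 < weight A b Set.univ := by
  unfold weight
  refine Finset.sum_pos (fun _ _ => Real.exp_pos _) ⟨fun _ => 1, by simp⟩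

/-! ### Asymptotics of the weights -/

lemma continuous_pressure {k : ℕ} (A : Matrix (Fin k) (Fin k) ℝ) :
    Continuous fun q : (Fin k → ℝ) × (Fin k → ℝ) => pressure A q.1 q.2 := by
  have h := continuous_entropyDeficit
  unfold pressure dotProduct Matrix.mulVec dotProduct
  simp only [Pi.mul_apply]
  fun_prop

lemma tendsto_blockFrac {k : ℕ} {N : ℕ → ℕ} {b : (n : ℕ) → Fin (N n) → Fin k} {γ : Fin k → ℝ}
    (hlim : ∀ i, Tendsto (fun n => Real.sqrt (((block (b n) i).card : ℝ) / (N n : ℝ)))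
      atTop (𝓝 (γ i))) :
    Tendsto (fun n => blockFrac (b n)) atTop (𝓝 (γ ^ 2)) := by
  rw [tendsto_pi_nhds]
  intro i
  refine ((hlim i).pow 2).congr fun n => ?_
  rw [Real.sq_sqrt (by positivity)]
  rfl

/-- Joint continuity gives the strict inequality near each (p₀, m); compactness of the cube then
yields one neighbourhood of `p₀` valid for all `m`. -/
lemma eventually_forall_pressure_le {k : ℕ} (A : Matrix (Fin k) (Fin k) ℝ) (p₀ : Fin k → ℝ)
    {ε : ℝ} (hε : 0 < ε) :
    ∀ᶠ p in 𝓝 p₀, ∀ m ∈ Set.Icc (-1 : Fin k → ℝ) 1, pressure A p m < pressure A p₀ m + ε := by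
  refine isCompact_Icc.eventually_forall_of_forall_eventually fun m _ => ?_
  have h1 : Continuous fun q : (Fin k → ℝ) × (Fin k → ℝ) => pressure A p₀ q.2 + ε :=
    ((continuous_pressure A).comp (by fun_prop :
      Continuous fun q : (Fin k → ℝ) × (Fin k → ℝ) => (p₀, q.2))).add continuous_const
  exact (continuous_pressure A).continuousAt.eventually_lt h1.continuousAt (by simpa using hε)

lemma eventually_const_mul_log_le (K : ℝ) {ε : ℝ} (hε : 0 < ε) :
    ∀ᶠ n : ℕ in atTop, K * (2 + 2 * Real.log ((n : ℝ) + 1)) ≤ n * ε := by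
  have h : (fun x : ℝ => K * (2 + 2 * Real.log x)) =o[atTop] (id : ℝ → ℝ) :=
    ((Asymptotics.isLittleO_const_id_atTop 2).add
      (Real.isLittleO_log_id_atTop.const_mul_left 2)).const_mul_left K
  have hn : Tendsto (fun n : ℕ => (n : ℝ) + 1) atTop atTop :=
    tendsto_natCast_atTop_atTop.atTop_add tendsto_const_nhds
  filter_upwards [hn.eventually (h.bound (half_pos hε)), eventually_ge_atTop 1] with n h1 h2
  have h3 : (1 : ℝ) ≤ n := by exact_mod_cast h2
  have h4 := (le_abs_self _).trans h1
  rw [id, Real.norm_of_nonneg (by positivity)] at h4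
  nlinarith

lemma eventually_weight_le {k : ℕ} (A : Matrix (Fin k) (Fin k) ℝ) {N : ℕ → ℕ}
    (hN : Tendsto N atTop atTop) {b : (n : ℕ) → Fin (N n) → Fin k} {p₀ : Fin k → ℝ}
    (hp : Tendsto (fun n => blockFrac (b n)) atTop (𝓝 p₀)) {B : Set (Fin k → ℝ)} {r : ℝ}
    (hr : ∀ m ∈ B ∩ Set.Icc (-1) 1, pressure A p₀ m ≤ r) {ε : ℝ} (hε : 0 < ε) :
    ∀ᶠ n in atTop, weight A (b n) B ≤ Real.exp (N n * (Real.log 2 + r + ε)) := by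
  filter_upwards [hp.eventually (eventually_forall_pressure_le A p₀ (half_pos hε)),
    hN.eventually (eventually_const_mul_log_le k (half_pos hε)), hN.eventually_ge_atTop 1]
    with n h1 h2 h3
  have h4 := weight_le h3 A (b n) B (r + ε / 2) fun m hm => by
    linarith [h1 m hm.2, hr m hm]
  refine h4.trans ?_
  -- The number of classes is absorbed into ε/2 of the exponent, as k log(N+1) is below the Stirling
  -- error already controlled in `h2`.
  have h5 : ((N n : ℝ) + 1) ^ k ≤ Real.exp (N n * (ε / 2)) := by
    rw [← Real.log_le_iff_le_exp (by positivity), Real.log_pow]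
    refine le_trans ?_ h2
    have h6 : 0 ≤ Real.log ((N n : ℝ) + 1) :=
      Real.log_nonneg (by linarith [Nat.cast_nonneg (α := ℝ) (N n)])
    gcongr
    linarith
  refine (mul_le_mul_of_nonneg_right h5 (Real.exp_nonneg _)).trans_eq ?_
  rw [← Real.exp_add]
  ring_nf

/-- Points of the cube are limits of attainable block magnetizations. -/
lemma exists_tendsto_gridPoint {k : ℕ} {N : ℕ → ℕ} (hN : Tendsto N atTop atTop)
    {b : (n : ℕ) → Fin (N n) → Fin k} {p₀ : Fin k → ℝ} (hp₀ : ∀ i, 0 < p₀ i)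
    (hp : Tendsto (fun n => blockFrac (b n)) atTop (𝓝 p₀)) {x : Fin k → ℝ}
    (hx : x ∈ Set.Icc (-1 : Fin k → ℝ) 1) :
    ∃ c : ℕ → Fin k → ℕ, (∀ n i, c n i ≤ (block (b n) i).card) ∧
      Tendsto (fun n => gridPoint (b n) (c n)) atTop (𝓝 x) := by
  have hx1 : ∀ i, -1 ≤ x i := fun i => hx.1 i
  have hx2 : ∀ i, x i ≤ 1 := fun i => hx.2 i
  -- Magnetization x_i requires a fraction (1 + x_i)/2 of positive spins. As `p₀ i` is positive, the
  -- block sizes tend to infinity and the rounding error disappears.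
  refine ⟨fun n i => ⌊(1 + x i) / 2 * ((block (b n) i).card : ℝ)⌋₊, fun n i => ?_, ?_⟩
  · refine Nat.floor_le_of_le ?_
    exact mul_le_of_le_one_left (by positivity) (by linarith [hx2 i])
  · rw [tendsto_pi_nhds]
    intro i
    have hN' : Tendsto (fun n => (N n : ℝ)) atTop atTop := tendsto_natCast_atTop_atTop.comp hN
    have hcard : Tendsto (fun n => ((block (b n) i).card : ℝ)) atTop atTop := by
      refine (((tendsto_pi_nhds.1 hp i).pos_mul_atTop (hp₀ i) hN')).congr' ?_
      filter_upwards [hN.eventually_ge_atTop 1] with n hn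
      have : (N n : ℝ) ≠ 0 := by positivity
      unfold blockFrac
      field_simp
    have h1 := (tendsto_nat_floor_mul_div_atTop (R := ℝ) (a := (1 + x i) / 2)
      (by linarith [hx1 i])).comp hcard
    have h2 := (h1.const_mul 2).sub_const 1
    have e : 2 * ((1 + x i) / 2) - 1 = x i := by ring
    rw [e] at h2
    refine h2.congr' ?_
    filter_upwards [hcard.eventually_gt_atTop 0] with n hn
    simp only [Function.comp, gridPoint]
    field_simp

lemma eventually_le_weight {k : ℕ} (A : Matrix (Fin k) (Fin k) ℝ) {N : ℕ → ℕ}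
    (hN : Tendsto N atTop atTop) {b : (n : ℕ) → Fin (N n) → Fin k} {p₀ : Fin k → ℝ}
    (hp₀ : ∀ i, 0 < p₀ i) (hp : Tendsto (fun n => blockFrac (b n)) atTop (𝓝 p₀))
    {B : Set (Fin k → ℝ)} {x : Fin k → ℝ} (hx : x ∈ Set.Icc (-1 : Fin k → ℝ) 1)
    (hxB : x ∈ interior B) {ε : ℝ} (hε : 0 < ε) :
    ∀ᶠ n in atTop, Real.exp (N n * (Real.log 2 + pressure A p₀ x - ε)) ≤ weight A (b n) B := by
  obtain ⟨c, hc, hlim⟩ := exists_tendsto_gridPoint hN hp₀ hp hx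
  have hpr := ((continuous_pressure A).tendsto (p₀, x)).comp (hp.prodMk_nhds hlim)
  have hB : ∀ᶠ n in atTop, gridPoint (b n) (c n) ∈ B :=
    hlim.eventually_mem (mem_interior_iff_mem_nhds.1 hxB)
  filter_upwards [hpr.eventually_const_lt (sub_lt_self _ (half_pos hε)),
    hN.eventually (eventually_const_mul_log_le k (half_pos hε)), hN.eventually_ge_atTop 1, hB] with n h1 h2 h3 h4
  refine le_trans (Real.exp_le_exp.2 ?_) (le_weight h3 A (b n) B (hc n) h4)
  simp only [Function.comp_apply] at h1
  have h5 := mul_le_mul_of_nonneg_left h1.le (Nat.cast_nonneg (α := ℝ) (N n))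
  linarith

lemma exists_isMaxOn_pressure {k : ℕ} (A : Matrix (Fin k) (Fin k) ℝ) (p : Fin k → ℝ) :
    ∃ x ∈ Set.Icc (-1 : Fin k → ℝ) 1, IsMaxOn (pressure A p) (Set.Icc (-1) 1) x :=
  isCompact_Icc.exists_isMaxOn ⟨0, fun _ => by simp, fun _ => by simp⟩
    ((continuous_pressure A).comp
      (by fun_prop : Continuous fun m : Fin k → ℝ => (p, m))).continuousOn

/-! ### The rate function in terms of the limiting pressure -/

lemma energyEntropy_of_mem {k : ℕ} (A : Matrix (Fin k) (Fin k) ℝ) (γ : Fin k → ℝ) {x : Fin k → ℝ}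
    (hx : x ∈ Set.Icc (-1 : Fin k → ℝ) 1) :
    energyEntropy A γ x = (pressure A (γ ^ 2) x : EReal) := by
  have h1 : ∑ i, ((γ i ^ 2 : ℝ) : EReal) * logCoshConj (x i) =
      ((∑ i, γ i ^ 2 * entropyDeficit (x i) : ℝ) : EReal) := by
    have hsum : ∀ (f : Fin k → ℝ), ((∑ i, f i : ℝ) : EReal) = ∑ i, (f i : EReal) := fun f =>
      map_sum (⟨⟨Real.toEReal, EReal.coe_zero⟩, EReal.coe_add⟩ : ℝ →+ EReal) f _
    rw [hsum]
    refine Finset.sum_congr rfl fun i _ => ?_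
    rw [logCoshConj_of_mem ⟨hx.1 i, hx.2 i⟩, EReal.coe_mul]
  have h2 : x ⬝ᵥ ((Matrix.diagonal γ) ^ 2 * A * (Matrix.diagonal γ) ^ 2).mulVec x =
      (γ ^ 2 * x) ⬝ᵥ A.mulVec (γ ^ 2 * x) := by
    rw [Matrix.diagonal_pow]
    simp only [dotProduct, Matrix.mulVec, Matrix.mul_diagonal, Matrix.diagonal_mul, Pi.mul_apply,
      Pi.pow_apply, Finset.mul_sum]
    refine Finset.sum_congr rfl fun i _ => Finset.sum_congr rfl fun j _ => ?_
    ring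
  rw [energyEntropy, h1, h2, ← EReal.coe_sub]
  rfl

/-- Some coordinate has infinite L*. Positivity of γ keeps its coefficient from cancelling it (in
`EReal`, 0 · ⊤ = 0), and the other summands are nonnegative, so no ∞ - ∞ arises. -/
lemma energyEntropy_of_notMem {k : ℕ} (A : Matrix (Fin k) (Fin k) ℝ) {γ : Fin k → ℝ}
    (hγ : ∀ i, 0 < γ i) {x : Fin k → ℝ} (hx : x ∉ Set.Icc (-1 : Fin k → ℝ) 1) :
    energyEntropy A γ x = ⊥ := by
  classical
  obtain ⟨i, hi⟩ : ∃ i, x i ∉ Set.Icc (-1 : ℝ) 1 := by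
    by_contra! h
    exact hx ⟨fun i => (h i).1, fun i => (h i).2⟩
  have hnonneg : ∀ y, 0 ≤ logCoshConj y := fun y => by simpa using le_logCoshConj y 0
  have h1 : ∑ i, ((γ i ^ 2 : ℝ) : EReal) * logCoshConj (x i) = ⊤ := by
    rw [← Finset.add_sum_erase _ _ (Finset.mem_univ i), logCoshConj_of_notMem hi,
      EReal.coe_mul_top_of_pos (pow_pos (hγ i) 2)]
    refine EReal.top_add_of_ne_bot (ne_of_gt (lt_of_lt_of_le EReal.bot_lt_zero ?_))
    exact Finset.sum_nonneg fun j _ =>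
      mul_nonneg (EReal.coe_nonneg.2 (sq_nonneg _)) (hnonneg _)
  rw [energyEntropy, h1, EReal.sub_top]

section Rate

variable {k : ℕ} {A : Matrix (Fin k) (Fin k) ℝ} {γ : Fin k → ℝ} {y : Fin k → ℝ}

lemma iSup_energyEntropy (hγ : ∀ i, 0 < γ i) (hy : y ∈ Set.Icc (-1 : Fin k → ℝ) 1)
    (hmax : IsMaxOn (pressure A (γ ^ 2)) (Set.Icc (-1) 1) y) :
    ⨆ x, energyEntropy A γ x = (pressure A (γ ^ 2) y : EReal) := by
  refine le_antisymm (iSup_le fun x => ?_) ?_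
  · by_cases hx : x ∈ Set.Icc (-1 : Fin k → ℝ) 1
    · rw [energyEntropy_of_mem A γ hx]
      exact EReal.coe_le_coe_iff.2 (hmax hx)
    · rw [energyEntropy_of_notMem A hγ hx]
      exact bot_le
  · rw [← energyEntropy_of_mem A γ hy]
    exact le_iSup (energyEntropy A γ) y

lemma rate_of_mem (hγ : ∀ i, 0 < γ i) (hy : y ∈ Set.Icc (-1 : Fin k → ℝ) 1)
    (hmax : IsMaxOn (pressure A (γ ^ 2)) (Set.Icc (-1) 1) y) {x : Fin k → ℝ}
    (hx : x ∈ Set.Icc (-1 : Fin k → ℝ) 1) :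
    rate A γ x = ((pressure A (γ ^ 2) y - pressure A (γ ^ 2) x : ℝ) : EReal) := by
  rw [rate, iSup_energyEntropy hγ hy hmax, energyEntropy_of_mem A γ hx, EReal.coe_sub]

lemma rate_of_notMem (hγ : ∀ i, 0 < γ i) (hy : y ∈ Set.Icc (-1 : Fin k → ℝ) 1)
    (hmax : IsMaxOn (pressure A (γ ^ 2)) (Set.Icc (-1) 1) y) {x : Fin k → ℝ}
    (hx : x ∉ Set.Icc (-1 : Fin k → ℝ) 1) : rate A γ x = ⊤ := by
  rw [rate, iSup_energyEntropy hγ hy hmax, energyEntropy_of_notMem A hγ hx, EReal.coe_sub_bot]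

/-- Real sublevel sets are closed subsets of the cube, since there the rate is a continuous function
and outside it is `⊤`. Lower semicontinuity follows from closedness of all sublevel sets. -/
lemma isGoodRateFunction_rate (A : Matrix (Fin k) (Fin k) ℝ) (hγ : ∀ i, 0 < γ i) :
    IsGoodRateFunction (rate A γ) := by
  obtain ⟨y, hy, hmax⟩ := exists_isMaxOn_pressure A (γ ^ 2)
  have hnonneg : ∀ x, 0 ≤ rate A γ x := by
    intro x
    by_cases hx : x ∈ Set.Icc (-1 : Fin k → ℝ) 1
    · rw [rate_of_mem hγ hy hmax hx]
      exact EReal.coe_nonneg.2 (sub_nonneg.2 (hmax hx))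
    · rw [rate_of_notMem hγ hy hmax hx]
      exact le_top
  have hcompact : ∀ L : ℝ, IsCompact {x | rate A γ x ≤ (L : EReal)} := by
    intro L
    have hcont : Continuous fun x => pressure A (γ ^ 2) y - pressure A (γ ^ 2) x :=
      continuous_const.sub ((continuous_pressure A).comp
        (by fun_prop : Continuous fun m : Fin k → ℝ => (γ ^ 2, m)))
    have e : {x | rate A γ x ≤ (L : EReal)} = Set.Icc (-1) 1 ∩
        {x | pressure A (γ ^ 2) y - pressure A (γ ^ 2) x ≤ L} := by
      ext x
      by_cases hx : x ∈ Set.Icc (-1 : Fin k → ℝ) 1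
      · simp only [Set.mem_ofPred_eq, Set.mem_inter_iff, hx, true_and,
          rate_of_mem hγ hy hmax hx, EReal.coe_le_coe_iff]
      · simp [Set.mem_inter_iff, hx, rate_of_notMem hγ hy hmax hx]
    rw [e]
    exact isCompact_Icc.inter_right (isClosed_le hcont continuous_const)
  refine ⟨hnonneg, lowerSemicontinuous_iff_isClosed_preimage.2 fun z => ?_, hcompact⟩
  induction z with
  | bot =>
    convert isClosed_empty
    ext x
    simpa using ne_of_gt (lt_of_lt_of_le EReal.bot_lt_zero (hnonneg x))
  | coe z => exact (hcompact z).isClosed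
  | top => simp

end Rate

/-! ### The large deviation principle -/

theorem satisfiesLDP_magnetization {k : ℕ} (A : Matrix (Fin k) (Fin k) ℝ) {N : ℕ → ℕ}
    (hN : StrictMono N) {b : (n : ℕ) → Fin (N n) → Fin k} {γ : Fin k → ℝ} (hγ : ∀ i, 0 < γ i)
    (hlim : ∀ i, Tendsto (fun n => Real.sqrt (((block (b n) i).card : ℝ) / (N n : ℝ)))
      atTop (𝓝 (γ i))) :
    SatisfiesLDP (fun n => (isingMeasure (interaction A (b n))).map (magnetization (b n)))
      (fun n => (N n : ℝ)) (rate A γ) := by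
  obtain ⟨y, hy, hmax⟩ := exists_isMaxOn_pressure A (γ ^ 2)
  have hN' := hN.tendsto_atTop
  have hp := tendsto_blockFrac hlim
  have hγ2 : ∀ i, 0 < (γ ^ 2) i := fun i => pow_pos (hγ i) 2
  refine ⟨fun n => ⟨?_⟩, fun n => Nat.cast_nonneg _,
    fun m n h => Nat.cast_le.2 (hN.monotone h), isGoodRateFunction_rate A hγ, ?_, ?_⟩
  · rw [map_magnetization_apply A (b n) MeasurableSet.univ,
      div_self (weight_univ_pos A (b n)).ne', ENNReal.ofReal_one]
  · intro B hB
    refine EReal.ge_of_forall_gt_iff_ge.1 fun z hz => ?_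
    rw [EReal.lt_neg_comm] at hz
    simp only [iInf_lt_iff] at hz
    obtain ⟨x, hxB, hz⟩ := hz
    have hx : x ∈ Set.Icc (-1 : Fin k → ℝ) 1 := by
      by_contra hx
      rw [rate_of_notMem hγ hy hmax hx] at hz
      exact not_top_lt hz
    rw [rate_of_mem hγ hy hmax hx, ← EReal.coe_neg, EReal.coe_lt_coe_iff] at hz
    -- One ε is spent on the weight of `B` in the numerator, the other on the partition function in
    -- the denominator.
    obtain ⟨ε, hε, hεz⟩ : ∃ ε > 0, z + 2 * ε ≤ pressure A (γ ^ 2) x - pressure A (γ ^ 2) y :=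
      ⟨(pressure A (γ ^ 2) x - pressure A (γ ^ 2) y - z) / 2, by linarith, by linarith⟩
    refine le_liminf_of_le (by isBoundedDefault) ?_
    filter_upwards [eventually_le_weight A hN' hγ2 hp hx hxB hε,
      eventually_weight_le A hN' hp (B := Set.univ) (fun m hm => hmax hm.2) hε,
      hN'.eventually_ge_atTop 1] with n h1 h2 h3
    have hpos : (0 : ℝ) < N n := by exact_mod_cast h3
    rw [EReal.le_div_iff_mul_le (EReal.coe_pos.2 hpos) (EReal.coe_ne_top _),
      map_magnetization_apply A (b n) hB, ← EReal.coe_mul]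
    have h4 : Real.exp (z * N n) ≤ weight A (b n) B / weight A (b n) Set.univ := by
      rw [le_div_iff₀ (weight_univ_pos A (b n))]
      refine le_trans (mul_le_mul_of_nonneg_left h2 (Real.exp_nonneg _)) (le_trans ?_ h1)
      rw [← Real.exp_add, Real.exp_le_exp]
      nlinarith
    refine le_trans ?_ (ENNReal.log_le_log (ENNReal.ofReal_le_ofReal h4))
    rw [ENNReal.log_ofReal_of_pos (Real.exp_pos _), Real.log_exp]
  · intro B hB
    refine EReal.le_of_forall_lt_iff_le.1 fun z hz => ?_
    -- The intermediate real `z'` leaves room for 2ε below `z`. It also covers an infinite infimum: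
    -- `z` is then arbitrary, and `hr` is vacuous when `B` misses the cube.
    obtain ⟨z', hz', hzz⟩ := EReal.lt_iff_exists_real_btwn.1 hz
    rw [EReal.coe_lt_coe_iff] at hzz
    have hr : ∀ m ∈ B ∩ Set.Icc (-1) 1,
        pressure A (γ ^ 2) m ≤ pressure A (γ ^ 2) y + z' := by
      intro m hm
      have h1 : -(rate A γ m) < (z' : EReal) :=
        lt_of_le_of_lt (EReal.neg_le_neg_iff.2 (iInf₂_le m (subset_closure hm.1))) hz'
      rw [rate_of_mem hγ hy hmax hm.2, ← EReal.coe_neg, EReal.coe_lt_coe_iff] at h1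
      linarith
    obtain ⟨ε, hε, hεz⟩ : ∃ ε > 0, z' + 2 * ε ≤ z := ⟨(z - z') / 2, by linarith, by linarith⟩
    refine limsup_le_of_le (by isBoundedDefault) ?_
    filter_upwards [eventually_weight_le A hN' hp hr hε,
      eventually_le_weight A hN' hγ2 hp (B := Set.univ) hy (by simp) hε,
      hN'.eventually_ge_atTop 1] with n h1 h2 h3
    have hpos : (0 : ℝ) < N n := by exact_mod_cast h3
    rw [EReal.div_le_iff_le_mul (EReal.coe_pos.2 hpos) (EReal.coe_ne_top _),
      map_magnetization_apply A (b n) hB, ← EReal.coe_mul]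
    have h4 : weight A (b n) B / weight A (b n) Set.univ ≤ Real.exp (N n * z) := by
      rw [div_le_iff₀ (weight_univ_pos A (b n))]
      refine le_trans h1 (le_trans ?_ (mul_le_mul_of_nonneg_left h2 (Real.exp_nonneg _)))
      rw [← Real.exp_add, Real.exp_le_exp]
      nlinarith
    refine le_trans (ENNReal.log_le_log (ENNReal.ofReal_le_ofReal h4)) ?_
    rw [ENNReal.log_ofReal_of_pos (Real.exp_pos _), Real.log_exp]

end BlockSpin

end

theorem theorem1p1 (k : ℕ) (A : Matrix (Fin k) (Fin k) ℝ) (hA : A.PosDef)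
    (N : ℕ → ℕ) (hN : StrictMono N) (b : (n : ℕ) → Fin (N n) → Fin k)
    (γ : Fin k → ℝ) (hγ : ∀ i, 0 < γ i)
    (hlim : ∀ i, Tendsto (fun n => Real.sqrt (((BlockSpin.block (b n) i).card : ℝ) / (N n : ℝ)))
      atTop (𝓝 (γ i))) :
    BlockSpin.SatisfiesLDP
      (fun n => (BlockSpin.isingMeasure (BlockSpin.interaction A (b n))).map
        (BlockSpin.magnetization (b n)))
      (fun n => (N n : ℝ)) (BlockSpin.rate A γ) ∧
    ∀ x ∈ Set.Icc (-1 : ℝ) 1, BlockSpin.logCoshConj x =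
      (((1 / 2) * (1 + x) * Real.log (1 + x) + (1 / 2) * (1 - x) * Real.log (1 - x) : ℝ) :
        EReal) := by
  refine ⟨BlockSpin.satisfiesLDP_magnetization A hN hγ hlim, fun x hx => ?_⟩
  rw [BlockSpin.logCoshConj_of_mem hx, BlockSpin.entropyDeficit_eq]
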